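/- Let $D$ be an infinite division ring (not necessarily commutative), let $n\ge 2$ be an integer, and let $G:=\mathrm{GL}_n(D)$ be the group of invertible $n\times n$ matrices over $D$. Let $\mathrm{SL}_n(D)$ be the subgroup of $G$ generated by the elementary matrices $I+c\,e_{ij}$ with $i\ne j$ and $c\in D$, where $e_{ij}$ denotes the matrix unit (equivalently, the kernel of the Dieudonné determinant on $G$). A subgroup $H$ of a group $G$ is called almost subnormal in $G$ if there is a finite chain of subgroups $H=H_r\le H_{r-1}\le\cdots\le H_1=G$ such that for each $1<i\le r$, either $H_i$ is normal in $H_{i-1}$ or $H_i$ has finite index in $H_{i-1}$; it is called subnormal if there is such a chain with $H_i$ normal in $H_{i-1}$ for each $1<i\le r$. Let $N$ be a non-central subgroup of $G$, that is, a subgroup not contained in the center of $G$. Then the following conditions are equivalent: 1. $N$ is almost subnormal in $G$. 2. $N$ is subnormal in $G$. 3. $N$ is normal in $G$. 4. $N$ contains $\mathrm{SL}_n(D)$. -/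

import Mathlib

/-- A subgroup `H` of `G` is almost subnormal (Hartley) if there is a finite descending chain
`G = S 0 ≥ S 1 ≥ ⋯ ≥ S r = H` of subgroups such that each `S (i + 1)` is normal in `S i` or has
finite index in `S i`. -/
def IsAlmostSubnormal {G : Type*} [Group G] (H : Subgroup G) : Prop :=
  ∃ (r : ℕ) (S : ℕ → Subgroup G), S 0 = ⊤ ∧ S r = H ∧
    ∀ i < r, S (i + 1) ≤ S i ∧
      (((S (i + 1)).subgroupOf (S i)).Normal ∨ ((S (i + 1)).subgroupOf (S i)).FiniteIndex)

/-- The special linear group `SL_n(D)` over a (possibly noncommutative) division ring `D`, as a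
subgroup of `GL_n(D)`: the subgroup generated by the elementary matrices `1 + c e_{ij}`, with
`i ≠ j` and `c` in `D`, where `e_{ij}` is the matrix unit (E. Artin's definition of the unimodular
group). For `2 ≤ n` it is the kernel of the Dieudonné determinant. -/
def specialLinearSubgroup (n : ℕ) (D : Type*) [DivisionRing D] :
    Subgroup (Matrix.GeneralLinearGroup (Fin n) D) :=
  Subgroup.closure {g | ∃ i j : Fin n, i ≠ j ∧ ∃ c : D,
    (g : Matrix (Fin n) (Fin n) D) = 1 + Matrix.single i j c}

/-! `GL_n(D)` acts on the lines of the left `D`-module of row vectors, and only central elements fix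
every line. `SL_n(D)` is 2-transitive on lines, hence primitive; it is generated by the abelian
groups of transvections with a given direction, and it is perfect because `D` is infinite. Iwasawa's
criterion then shows that a normal subgroup of `SL_n(D)` moving some line is everything
(`eq_top_of_normal_of_smul_ne`).

This lets `SL_n(D)` descend along an almost subnormal chain. At a normal step, a commutator with a
non-central element yields a line-moving element of the intersection with `SL_n(D)`; at a
finite-index step, the pigeonhole principle puts a nontrivial transvection in the normal core.
Conversely, row reduction shows that `GL_n(D)` modulo `SL_n(D)` is abelian, so every subgroup above
`SL_n(D)` is normal. -/

section

open Matrix Projectivization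
open scoped commutatorElement LinearAlgebra.Projectivization Pointwise

variable {n : ℕ} {D : Type*} [DivisionRing D]

/-! ### Elementary and diagonal matrices; perfectness of `SL_n(D)` -/

/-- The elementary matrix `1 + c e_{ij}` as a unit. -/
def elementaryUnit (i j : Fin n) (hij : i ≠ j) (c : D) : GeneralLinearGroup (Fin n) D where
  val := 1 + single i j c
  inv := 1 + single i j (-c)
  val_inv := by
    simp [mul_add, add_mul, single_mul_single_of_ne, hij.symm, add_assoc, ← single_add]
  inv_val := by
    simp [mul_add, add_mul, single_mul_single_of_ne, hij.symm, add_assoc, ← single_add]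

/-- The diagonal matrix with unit entries `d i`, as a unit. -/
def diagonalUnit (d : Fin n → Dˣ) : GeneralLinearGroup (Fin n) D where
  val := diagonal fun i => (d i : D)
  inv := diagonal fun i => ((d i)⁻¹ : Dˣ)
  val_inv := by simp [diagonal_mul_diagonal]
  inv_val := by simp [diagonal_mul_diagonal]

lemma vecMul_elementaryUnit {i j : Fin n} (hij : i ≠ j) (c : D) (w : Fin n → D) :
    w ᵥ* (elementaryUnit i j hij c).val = w + Pi.single j (w i * c) := by
  change w ᵥ* (1 + single i j c) = _
  rw [vecMul_add, vecMul_one]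
  congr 1
  ext k
  simp [vecMul, dotProduct, single_apply, Pi.single_apply, ite_and, eq_comm]

lemma elementaryUnit_inv {i j : Fin n} (hij : i ≠ j) (c : D) :
    (elementaryUnit i j hij c)⁻¹ = elementaryUnit i j hij (-c) := by
  ext; rfl

lemma elementaryUnit_mul {i j : Fin n} (hij : i ≠ j) (b c : D) :
    elementaryUnit i j hij b * elementaryUnit i j hij c = elementaryUnit i j hij (b + c) := by
  ext1
  simp [elementaryUnit, mul_add, add_mul, single_mul_single_of_ne, hij.symm, single_add, add_assoc]

lemma vecMul_diagonalUnit (d : Fin n → Dˣ) (w : Fin n → D) :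
    w ᵥ* (diagonalUnit d).val = fun i => w i * d i := by
  ext; simp [diagonalUnit, vecMul_diagonal]

lemma elementaryUnit_mem {i j : Fin n} (hij : i ≠ j) (c : D) :
    elementaryUnit i j hij c ∈ specialLinearSubgroup n D :=
  Subgroup.subset_closure ⟨i, j, hij, c, rfl⟩

lemma specialLinearSubgroup_le_iff {K : Subgroup (GeneralLinearGroup (Fin n) D)} :
    specialLinearSubgroup n D ≤ K ↔ ∀ i j (hij : i ≠ j) (c : D), elementaryUnit i j hij c ∈ K := by
  refine ⟨fun h i j hij c => h (elementaryUnit_mem hij c), fun h => ?_⟩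
  rw [specialLinearSubgroup, Subgroup.closure_le]
  rintro g ⟨i, j, hij, c, hg⟩
  rw [show g = elementaryUnit i j hij c from Units.ext hg]
  exact h i j hij c

lemma ext_vecMul {g h : GeneralLinearGroup (Fin n) D}
    (H : ∀ w : Fin n → D, w ᵥ* g.val = w ᵥ* h.val) : g = h :=
  Units.ext (ext_iff_vecMul.2 H)

lemma vecMul_val_injective (g : GeneralLinearGroup (Fin n) D) :
    Function.Injective fun w : Fin n → D => w ᵥ* g.val :=
  vecMul_injective_of_isUnit g.isUnit

/-- The diagonal matrix with `a` at `i` and `b` at `j`. -/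
def diagonalPair (i j : Fin n) (a b : Dˣ) : GeneralLinearGroup (Fin n) D :=
  diagonalUnit (Function.update (Function.update 1 j b) i a)

lemma vecMul_diagonalPair {i j : Fin n} (hij : i ≠ j) (a b : Dˣ) (w : Fin n → D) :
    w ᵥ* (diagonalPair i j a b).val =
      w + Pi.single i (w i * (a - 1)) + Pi.single j (w j * (b - 1)) := by
  rw [diagonalPair, vecMul_diagonalUnit]
  ext k
  rcases eq_or_ne k i with rfl | hi
  · simp [hij, mul_sub]
  rcases eq_or_ne k j with rfl | hj
  · simp [hij.symm, mul_sub]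
  · simp [hi, hj]

lemma diagonalPair_mem {i j : Fin n} (hij : i ≠ j) (a : Dˣ) :
    diagonalPair i j a a⁻¹ ∈ specialLinearSubgroup n D := by
  -- Whitehead's identity: the product `w(a) w(-1)`, where `w(a) = e_ij(a) e_ji(-a⁻¹) e_ij(a)` is
  -- monomial.
  have key : diagonalPair i j a a⁻¹ =
      elementaryUnit i j hij (a : D) * elementaryUnit j i hij.symm (-(a⁻¹ : Dˣ) : D) *
      elementaryUnit i j hij (a : D) * (elementaryUnit i j hij (-1) *
      elementaryUnit j i hij.symm 1 * elementaryUnit i j hij (-1)) := by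
    refine ext_vecMul fun w => ?_
    rw [vecMul_diagonalPair hij]
    simp only [Units.val_mul, ← vecMul_vecMul, vecMul_elementaryUnit]
    ext k
    rcases eq_or_ne k i with rfl | hi
    · simp [hij, mul_sub, add_mul]
    rcases eq_or_ne k j with rfl | hj
    · simp [hij.symm, mul_sub, add_mul]
    · simp [hi, hj]
  rw [key]
  have h1 := fun c : D => elementaryUnit_mem hij c
  have h2 := fun c : D => elementaryUnit_mem hij.symm c
  exact mul_mem (mul_mem (mul_mem (h1 _) (h2 _)) (h1 _)) (mul_mem (mul_mem (h1 _) (h2 _)) (h1 _))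

/-- If `a` commutes with `c` and `a ^ 2 ≠ 1`, then `1 + c e_{ij}` is a commutator. -/
lemma elementaryUnit_mem_commutator {i j : Fin n} (hij : i ≠ j) {c : D} {a : Dˣ}
    (hac : Commute (a : D) c) (ha : (a : D) * a ≠ 1) :
    elementaryUnit i j hij c ∈ ⁅specialLinearSubgroup n D, specialLinearSubgroup n D⁆ := by
  -- Conjugation by `diag(a, a⁻¹)` turns the entry `b` into `a b a`, so `b` must solve `a b a - b =
  -- c`.
  set b : D := ((a : D) * a - 1)⁻¹ * c
  have hb : (a : D) * b * a = c + b := by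
    have h1 : Commute (a : D) ((a : D) * a - 1)⁻¹ :=
      (((Commute.refl (a : D)).mul_right (Commute.refl _)).sub_right (Commute.one_right _)).inv_right₀
    have h2 : (a : D) * b * a - b = ((a : D) * a - 1) * b := by
      rw [mul_assoc, ← (h1.mul_right hac).eq, sub_mul, one_mul, mul_assoc]
    rw [← sub_eq_iff_eq_add, h2, mul_inv_cancel_left₀ (sub_ne_zero.2 ha)]
  have key : elementaryUnit i j hij c = ⁅diagonalPair i j a a⁻¹, elementaryUnit i j hij b⁆ := by
    rw [commutatorElement_def, eq_mul_inv_iff_mul_eq, eq_mul_inv_iff_mul_eq]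
    refine ext_vecMul fun w => ?_
    simp only [Units.val_mul, ← vecMul_vecMul, vecMul_elementaryUnit, vecMul_diagonalPair hij]
    ext k
    have h3 : c * (a⁻¹ : Dˣ) + b * (a⁻¹ : Dˣ) = a * b := by rw [← add_mul, ← hb]; simp
    rcases eq_or_ne k i with rfl | hi
    · simp [hij, mul_sub, add_mul]
    rcases eq_or_ne k j with rfl | hj
    · simp [hij.symm, hij, mul_sub, add_mul, mul_assoc, ← h3, mul_add]
      abel
    · simp [hi, hj]
  rw [key]
  exact Subgroup.commutator_mem_commutator (diagonalPair_mem hij a) (elementaryUnit_mem hij b)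

/-- The choice `a = c` works unless `c` is `0` or `±1`; then `c` is central and any `a` outside `{0,
1, -1}` will do. -/
lemma exists_commute_sq_ne_one [Infinite D] (c : D) : ∃ a : Dˣ, Commute (a : D) c ∧ (a : D) * a ≠ 1 := by
  classical
  by_cases hc : c = 0 ∨ c = 1 ∨ c = -1
  · obtain ⟨a, ha⟩ := Infinite.exists_notMem_finset ({0, 1, -1} : Finset D)
    simp only [Finset.mem_insert, Finset.mem_singleton, not_or] at ha
    refine ⟨Units.mk0 a ha.1, ?_, ?_⟩
    · rcases hc with rfl | rfl | rfl <;> simp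
    · simpa [mul_self_eq_one_iff] using ha.2
  · simp only [not_or] at hc
    exact ⟨Units.mk0 c hc.1, Commute.refl _, by simpa [mul_self_eq_one_iff] using hc.2⟩

lemma commutator_specialLinearSubgroup [Infinite D] :
    ⁅specialLinearSubgroup n D, specialLinearSubgroup n D⁆ = specialLinearSubgroup n D := by
  refine le_antisymm (Subgroup.commutator_le_self _) (specialLinearSubgroup_le_iff.2 fun i j hij c => ?_)
  obtain ⟨a, h1, h2⟩ := exists_commute_sq_ne_one c
  exact elementaryUnit_mem_commutator hij h1 h2

/-! ### Row reduction -/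

lemma exists_mem_vecMul_eq_add {k : Fin n} (w : Fin n → D) (hw : w k = 0) :
    ∃ h ∈ specialLinearSubgroup n D, ∀ x : Fin n → D, x ᵥ* h.val = x + x k • w := by
  suffices H : ∀ s : Finset (Fin n), ∃ h ∈ specialLinearSubgroup n D,
      ∀ x : Fin n → D, x ᵥ* h.val = x + x k • ∑ j ∈ s, Pi.single j (w j) by
    simpa [Finset.univ_sum_single] using H Finset.univ
  intro s
  induction s using Finset.induction_on with
  | empty => exact ⟨1, one_mem _, by simp⟩
  | insert j s hj ih =>
    obtain ⟨h, hh, H⟩ := ih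
    rcases eq_or_ne k j with rfl | hkj
    · exact ⟨h, hh, fun x => by simp [H, Finset.sum_insert hj, hw]⟩
    · have h0 : (∑ i ∈ s, Pi.single i (w i) : Fin n → D) k = 0 := by
        simp only [Finset.sum_apply, Pi.single_apply]
        refine Finset.sum_eq_zero fun i _ => ?_
        split_ifs with h
        · rw [← h, hw]
        · rfl
      refine ⟨h * elementaryUnit k j hkj (w j), mul_mem hh (elementaryUnit_mem _ _), fun x => ?_⟩
      rw [Units.val_mul, ← vecMul_vecMul, H, vecMul_elementaryUnit, Finset.sum_insert hj]
      simp only [Pi.add_apply, Pi.smul_apply, h0, smul_eq_mul, mul_zero, add_zero, smul_add,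
        ← Pi.single_smul]
      abel

lemma exists_mem_vecMul_eq_single_self {k : Fin n} {v : Fin n → D} (hv : v k ≠ 0) :
    ∃ h ∈ specialLinearSubgroup n D,
      (∀ i ≠ k, Pi.single i (1 : D) ᵥ* h.val = Pi.single i 1) ∧ v ᵥ* h.val = Pi.single k (v k) := by
  -- The added row vanishes at `k`, and `v k` times it cancels `v` except at `k`.
  obtain ⟨h, hh, H⟩ := exists_mem_vecMul_eq_add (k := k) (Pi.single k 1 - (v k)⁻¹ • v) (by simp [hv])
  refine ⟨h, hh, fun i hi => by simp [H, hi.symm], ?_⟩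
  rw [H, smul_sub, smul_smul, mul_inv_cancel₀ hv, one_smul, ← Pi.single_smul]
  simp

/-- Here and below, `S` indexes the rows already reduced, which later operations must preserve. -/
lemma exists_mem_vecMul_ne_zero {S : Set (Fin n)} {j k : Fin n} (hj : j ∉ S) (hk : k ∉ S)
    {v : Fin n → D} (hv : v j ≠ 0) :
    ∃ h ∈ specialLinearSubgroup n D,
      (∀ i ∈ S, Pi.single i (1 : D) ᵥ* h.val = Pi.single i 1) ∧ (v ᵥ* h.val) k ≠ 0 := by
  by_cases hvk : v k = 0
  · have hjk : j ≠ k := by rintro rfl; exact hv hvk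
    refine ⟨elementaryUnit j k hjk 1, elementaryUnit_mem _ _, fun i hi => ?_, ?_⟩
    · have : j ≠ i := by rintro rfl; exact hj hi
      rw [vecMul_elementaryUnit]; simp [this]
    · simpa [vecMul_elementaryUnit, hvk] using hv
  · exact ⟨1, one_mem _, by simp, by simpa using hvk⟩

lemma exists_mem_vecMul_eq_single {S : Set (Fin n)} {j k : Fin n} (hj : j ∉ S) (hk : k ∉ S)
    {v : Fin n → D} (hv : v j ≠ 0) :
    ∃ h ∈ specialLinearSubgroup n D,
      (∀ i ∈ S, Pi.single i (1 : D) ᵥ* h.val = Pi.single i 1) ∧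
      ∃ c : D, c ≠ 0 ∧ v ᵥ* h.val = Pi.single k c := by
  obtain ⟨h₁, hh₁, H₁, hne⟩ := exists_mem_vecMul_ne_zero hj hk hv
  obtain ⟨h₂, hh₂, H₂, he⟩ := exists_mem_vecMul_eq_single_self hne
  refine ⟨h₁ * h₂, mul_mem hh₁ hh₂, fun i hi => ?_, _, hne, ?_⟩
  · rw [Units.val_mul, ← vecMul_vecMul, H₁ i hi, H₂ i (by rintro rfl; exact hk hi)]
  · rw [Units.val_mul, ← vecMul_vecMul, he]

/-- The spare index `z` is what allows the pivot to be normalized to `1`: a nonzero entry there can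
correct the entry at `k`. -/
lemma exists_mem_vecMul_eq_single_one {S : Set (Fin n)} {j k z : Fin n} (hj : j ∉ S) (hk : k ∉ S)
    (hz : z ∉ S) (hzk : z ≠ k) {v : Fin n → D} (hv : v j ≠ 0) :
    ∃ h ∈ specialLinearSubgroup n D,
      (∀ i ∈ S, Pi.single i (1 : D) ᵥ* h.val = Pi.single i 1) ∧ v ᵥ* h.val = Pi.single k 1 := by
  obtain ⟨h₁, hh₁, H₁, hne⟩ := exists_mem_vecMul_ne_zero hj hz hv
  set v₁ := v ᵥ* h₁.val
  let t := elementaryUnit z k hzk ((v₁ z)⁻¹ * (1 - v₁ k))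
  have ht : (v₁ ᵥ* t.val) k = 1 := by
    simp [t, vecMul_elementaryUnit, mul_inv_cancel_left₀ hne]
  obtain ⟨h₂, hh₂, H₂, he⟩ := exists_mem_vecMul_eq_single_self (ht ▸ one_ne_zero)
  refine ⟨h₁ * t * h₂, mul_mem (mul_mem hh₁ (elementaryUnit_mem _ _)) hh₂, fun i hi => ?_, ?_⟩
  · have h3 : z ≠ i := by rintro rfl; exact hz hi
    have h4 : Pi.single i (1 : D) ᵥ* t.val = Pi.single i 1 := by
      rw [vecMul_elementaryUnit]; simp [h3]
    simp only [Units.val_mul, ← vecMul_vecMul]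
    rw [H₁ i hi, h4, H₂ i (by rintro rfl; exact hk hi)]
  · simp only [Units.val_mul, ← vecMul_vecMul]
    rw [he, ht]

/-- If row `k` of `g` were supported in `S`, then `g` would fix it; by injectivity it would equal
`e_k`, contradicting `k ∉ S`. -/
lemma exists_ne_zero_of_forall_single_vecMul {g : GeneralLinearGroup (Fin n) D}
    {S : Set (Fin n)} (hS : ∀ i ∈ S, Pi.single i (1 : D) ᵥ* g.val = Pi.single i 1) {k : Fin n}
    (hk : k ∉ S) : ∃ j ∉ S, (Pi.single k (1 : D) ᵥ* g.val) j ≠ 0 := by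
  by_contra! H
  set v := Pi.single k (1 : D) ᵥ* g.val with hv
  have h1 : v ᵥ* g.val = v := by
    conv_lhs => rw [← Finset.univ_sum_single v]
    conv_rhs => rw [← Finset.univ_sum_single v]
    rw [sum_vecMul]
    refine Finset.sum_congr rfl fun i _ => ?_
    by_cases hi : i ∈ S
    · rw [← mul_one (v i), ← smul_eq_mul, Pi.single_smul, smul_vecMul, hS i hi]
    · simp [H i hi]
  have h2 : v = Pi.single k 1 := vecMul_val_injective g (h1.trans hv)
  have h3 := H k hk
  rw [h2] at h3
  simp at h3

/-- The diagonal matrix with `a` at `z` and `1` elsewhere. -/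
def diagonalSingle (z : Fin n) (a : Dˣ) : GeneralLinearGroup (Fin n) D :=
  diagonalUnit (Function.update 1 z a)

lemma exists_mul_eq_diagonalSingle (z : Fin n) (g : GeneralLinearGroup (Fin n) D) :
    ∃ h ∈ specialLinearSubgroup n D, ∃ a : Dˣ, g * h = diagonalSingle z a := by
  have H : ∀ S : Finset (Fin n), z ∉ S → ∃ h ∈ specialLinearSubgroup n D,
      ∀ i ∈ S, Pi.single i (1 : D) ᵥ* (g * h).val = Pi.single i 1 := by
    intro S
    induction S using Finset.induction_on with
    | empty => exact fun _ => ⟨1, one_mem _, by simp⟩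
    | insert k S hk ih =>
      intro hz
      simp only [Finset.mem_insert, not_or] at hz
      obtain ⟨h, hh, H⟩ := ih hz.2
      obtain ⟨j, hj, hne⟩ := exists_ne_zero_of_forall_single_vecMul (g := g * h) (S := S) H hk
      obtain ⟨h', hh', H', he⟩ := exists_mem_vecMul_eq_single_one (S := S) hj hk hz.2 hz.1 hne
      refine ⟨h * h', mul_mem hh hh', fun i hi => ?_⟩
      rw [← mul_assoc, Units.val_mul, ← vecMul_vecMul]
      rcases Finset.mem_insert.1 hi with rfl | hi
      · exact he
      · rw [H i hi, H' i hi]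
  obtain ⟨h, hh, H⟩ := H (Finset.univ.erase z) (by simp)
  have hz : z ∉ ((Finset.univ.erase z : Finset (Fin n)) : Set (Fin n)) := by simp
  obtain ⟨j, hj, hne⟩ :=
    exists_ne_zero_of_forall_single_vecMul (g := g * h)
      (S := (Finset.univ.erase z : Finset (Fin n))) H hz
  -- No spare index is left for the last row, so its pivot `c` survives.
  obtain ⟨h', hh', H', c, hc, he⟩ := exists_mem_vecMul_eq_single hj hz hne
  refine ⟨h * h', mul_mem hh hh', Units.mk0 c hc, Units.ext (ext_of_single_vecMul fun i => ?_)⟩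
  rw [← mul_assoc, Units.val_mul, ← vecMul_vecMul, diagonalSingle, vecMul_diagonalUnit]
  rcases eq_or_ne i z with rfl | hi
  · rw [he]
    ext k
    rcases eq_or_ne k i with rfl | hk <;> simp [*]
  · rw [H i (by simp [hi]), H' i (by simp [hi])]
    ext k
    rcases eq_or_ne k z with rfl | hk <;> simp [*]

/-! ### Normality of `SL_n(D)` and the abelian quotient -/

lemma diagonalUnit_conj_mem (d : Fin n → Dˣ) {g : GeneralLinearGroup (Fin n) D}
    (hg : g ∈ specialLinearSubgroup n D) :
    diagonalUnit d * g * (diagonalUnit d)⁻¹ ∈ specialLinearSubgroup n D := by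
  suffices H : specialLinearSubgroup n D ≤ Subgroup.comap
      (MulAut.conj (diagonalUnit d)).toMonoidHom (specialLinearSubgroup n D) by
    exact H hg
  refine specialLinearSubgroup_le_iff.2 fun i j hij c => ?_
  have : diagonalUnit d * elementaryUnit i j hij c * (diagonalUnit d)⁻¹ =
      elementaryUnit i j hij (d i * c * (d j)⁻¹ : D) := by
    rw [mul_inv_eq_iff_eq_mul]
    refine ext_vecMul fun w => ?_
    simp only [Units.val_mul, ← vecMul_vecMul, vecMul_elementaryUnit, vecMul_diagonalUnit]
    ext k
    rcases eq_or_ne k j with rfl | hk <;> simp [*, add_mul, mul_assoc]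
  change diagonalUnit d * elementaryUnit i j hij c * (diagonalUnit d)⁻¹ ∈ specialLinearSubgroup n D
  rw [this]
  exact elementaryUnit_mem _ _

instance specialLinearSubgroup_normal : (specialLinearSubgroup n D).Normal := by
  rcases isEmpty_or_nonempty (Fin n) with hn | ⟨⟨z⟩⟩
  · have : Subsingleton (GeneralLinearGroup (Fin n) D) := ⟨fun a b => Units.ext (Subsingleton.elim _ _)⟩
    exact ⟨fun g hg x => by rwa [Subsingleton.elim (x * g * x⁻¹) g]⟩
  refine ⟨fun g hg x => ?_⟩
  obtain ⟨h, hh, a, e⟩ := exists_mul_eq_diagonalSingle z x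
  obtain rfl : x = diagonalSingle z a * h⁻¹ := eq_mul_inv_of_mul_eq e
  have := diagonalUnit_conj_mem (Function.update 1 z a) (mul_mem (mul_mem (inv_mem hh) hg) hh)
  simpa [diagonalSingle, mul_assoc] using this

/-- Modulo `SL_n(D)` each element is a one-entry diagonal matrix whose entry can be placed at `z` or
at `y`; diagonal matrices with entries at distinct places commute. -/
lemma commutator_le_specialLinearSubgroup [Nontrivial (Fin n)] :
    commutator (GeneralLinearGroup (Fin n) D) ≤ specialLinearSubgroup n D := by
  obtain ⟨z, y, hzy⟩ := exists_pair_ne (Fin n)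
  rw [← QuotientGroup.ker_mk' (specialLinearSubgroup n D), commutator_def, Subgroup.commutator_le]
  set π := QuotientGroup.mk' (specialLinearSubgroup n D)
  have hπ : ∀ g ∈ specialLinearSubgroup n D, π g = 1 := fun g hg =>
    (QuotientGroup.eq_one_iff g).2 hg
  have hz : ∀ g, ∃ a : Dˣ, π g = π (diagonalSingle z a) := fun g => by
    obtain ⟨h, hh, a, e⟩ := exists_mul_eq_diagonalSingle z g
    exact ⟨a, by rw [← e, map_mul, hπ h hh, mul_one]⟩
  have hy : ∀ a : Dˣ, π (diagonalSingle z a) = π (diagonalSingle y a) := fun a => by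
    have : diagonalSingle z a = diagonalPair z y a a⁻¹ * diagonalSingle y a := by
      refine ext_vecMul fun w => ?_
      simp only [Units.val_mul, ← vecMul_vecMul, diagonalSingle, diagonalPair, vecMul_diagonalUnit]
      ext k
      rcases eq_or_ne k z with rfl | h1
      · simp [hzy]
      rcases eq_or_ne k y with rfl | h2
      · simp [h1]
      · simp [h1, h2]
    rw [this, map_mul, hπ _ (diagonalPair_mem hzy a), one_mul]
  intro g₁ _ g₂ _
  obtain ⟨a, ha⟩ := hz g₁
  obtain ⟨b, hb⟩ := hz g₂
  rw [MonoidHom.mem_ker, map_commutatorElement, commutatorElement_eq_one_iff_mul_comm, ha, hb, hy b,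
    ← map_mul, ← map_mul]
  congr 1
  refine ext_vecMul fun w => ?_
  simp only [Units.val_mul, ← vecMul_vecMul, diagonalSingle, vecMul_diagonalUnit]
  ext k
  rcases eq_or_ne k z with rfl | h1
  · simp [hzy]
  · simp [h1]

lemma normal_of_specialLinearSubgroup_le [Nontrivial (Fin n)]
    {N : Subgroup (GeneralLinearGroup (Fin n) D)} (hN : specialLinearSubgroup n D ≤ N) :
    N.Normal := by
  refine ⟨fun g hg x => ?_⟩
  have : ⁅x, g⁆ ∈ N := hN (commutator_le_specialLinearSubgroup
    (Subgroup.commutator_mem_commutator (Subgroup.mem_top x) (Subgroup.mem_top g)))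
  simpa [commutatorElement_def] using mul_mem this hg

/-! ### The action on lines of row vectors -/

/-- `GL_n(D)` acts `D`-linearly on the left `D`-module of row vectors. -/
def rowEquiv : GeneralLinearGroup (Fin n) D →* ((Fin n → D) ≃ₗ[D] (Fin n → D)) where
  toFun g :=
    -- The inverse turns right multiplication into a left action.
    { toFun := fun w => w ᵥ* (g⁻¹).val
      invFun := fun w => w ᵥ* g.val
      map_add' := fun v w => add_vecMul _ v w
      map_smul' := fun c w => smul_vecMul c w _
      left_inv := fun w => by simp [vecMul_vecMul, ← Units.val_mul]
      right_inv := fun w => by simp [vecMul_vecMul, ← Units.val_mul] }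
  map_one' := by
    ext1 w
    change w ᵥ* ((1 : GeneralLinearGroup (Fin n) D)⁻¹).val = w
    rw [inv_one, Units.val_one, vecMul_one]
  map_mul' g h := by
    ext1 w
    change w ᵥ* ((g * h)⁻¹).val = (w ᵥ* (h⁻¹).val) ᵥ* (g⁻¹).val
    rw [_root_.mul_inv_rev, Units.val_mul, vecMul_vecMul]

lemma rowEquiv_apply (g : GeneralLinearGroup (Fin n) D) (w : Fin n → D) :
    rowEquiv g w = w ᵥ* (g⁻¹).val := rfl

lemma rowEquiv_inv_apply (g : GeneralLinearGroup (Fin n) D) (w : Fin n → D) :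
    rowEquiv g⁻¹ w = w ᵥ* g.val := by rw [rowEquiv_apply, inv_inv]

lemma rowEquiv_mul_apply (g h : GeneralLinearGroup (Fin n) D) (w : Fin n → D) :
    rowEquiv (g * h) w = rowEquiv g (rowEquiv h w) := by rw [map_mul]; rfl

@[simp]
lemma rowEquiv_rowEquiv_inv (g : GeneralLinearGroup (Fin n) D) (w : Fin n → D) :
    rowEquiv g (rowEquiv g⁻¹ w) = w := by rw [← rowEquiv_mul_apply, mul_inv_cancel, map_one]; rfl

@[simp]
lemma rowEquiv_inv_rowEquiv (g : GeneralLinearGroup (Fin n) D) (w : Fin n → D) :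
    rowEquiv g⁻¹ (rowEquiv g w) = w := by rw [← rowEquiv_mul_apply, inv_mul_cancel, map_one]; rfl

lemma rowEquiv_elementaryUnit {i j : Fin n} (hij : i ≠ j) (c : D) (w : Fin n → D) :
    rowEquiv (elementaryUnit i j hij c) w = w + Pi.single j (w i * -c) := by
  rw [rowEquiv_apply, elementaryUnit_inv, vecMul_elementaryUnit]

instance lineAction : MulAction (GeneralLinearGroup (Fin n) D) (ℙ D (Fin n → D)) :=
  MulAction.compHom _ rowEquiv

lemma line_smul_mk (g : GeneralLinearGroup (Fin n) D) {v : Fin n → D} (hv : v ≠ 0) :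
    g • mk D v hv = mk D (rowEquiv g v) (by simpa using hv) := rfl

lemma subgroup_line_smul_mk {H : Subgroup (GeneralLinearGroup (Fin n) D)} (g : H) {v : Fin n → D}
    (hv : v ≠ 0) : g • mk D v hv = mk D (rowEquiv g v) (by simpa using hv) := rfl

lemma exists_smul_eq_mk_single {i j : Fin n} (hij : i ≠ j) {a b : ℙ D (Fin n → D)} (hab : a ≠ b) :
    ∃ g : specialLinearSubgroup n D,
      g • a = mk D (Pi.single i 1) (by simp) ∧ g • b = mk D (Pi.single j 1) (by simp) := by
  induction a with | h v hv => ?_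
  induction b with | h w hw => ?_
  obtain ⟨k, hk⟩ := Function.ne_iff.1 hv
  obtain ⟨h₁, hh₁, -, c, hc, e₁⟩ :=
    exists_mem_vecMul_eq_single (S := ∅) (Set.notMem_empty k) (Set.notMem_empty i) hk
  -- The lines differ, so once the first is `⟨e_i⟩` the second has a nonzero coordinate off `i`.
  have hl : ∃ l, l ∉ ({i} : Set (Fin n)) ∧ (w ᵥ* h₁.val) l ≠ 0 := by
    by_contra! H
    have hw₁ : w ᵥ* h₁.val = Pi.single i ((w ᵥ* h₁.val) i) := by
      ext l
      rcases eq_or_ne l i with rfl | hl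
      · simp
      · simp [hl, H l hl]
    have hne : (w ᵥ* h₁.val) i ≠ 0 := fun h0 => hw <| vecMul_val_injective h₁ <| by
      simpa [h0] using hw₁
    refine hab ((mk_eq_mk_iff' D v w hv hw).2 ⟨c * ((w ᵥ* h₁.val) i)⁻¹, vecMul_val_injective h₁ ?_⟩)
    simp only [smul_vecMul]
    rw [hw₁, e₁, ← Pi.single_smul]
    simp [hne]
  obtain ⟨l, hl, hne⟩ := hl
  obtain ⟨h₂, hh₂, H₂, c', hc', e₂⟩ :=
    exists_mem_vecMul_eq_single (S := {i}) (k := j) hl (by simpa using hij.symm) hne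
  refine ⟨⟨(h₁ * h₂)⁻¹, inv_mem (mul_mem hh₁ hh₂)⟩, ?_, ?_⟩
  · rw [subgroup_line_smul_mk, mk_eq_mk_iff']
    refine ⟨c, ?_⟩
    rw [rowEquiv_inv_apply, Units.val_mul, ← vecMul_vecMul, e₁, ← H₂ i rfl,
      ← smul_vecMul, ← Pi.single_smul]
    simp
  · rw [subgroup_line_smul_mk, mk_eq_mk_iff']
    refine ⟨c', ?_⟩
    rw [rowEquiv_inv_apply, Units.val_mul, ← vecMul_vecMul, e₂, ← Pi.single_smul]
    simp

instance specialLinearSubgroup_isPreprimitive [Nontrivial (Fin n)] :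
    MulAction.IsPreprimitive (specialLinearSubgroup n D) (ℙ D (Fin n → D)) := by
  apply MulAction.isPreprimitive_of_is_two_pretransitive
  rw [MulAction.is_two_pretransitive_iff]
  intro a b a' b' hab hab'
  obtain ⟨i, j, hij⟩ := exists_pair_ne (Fin n)
  obtain ⟨g, h1, h2⟩ := exists_smul_eq_mk_single hij hab
  obtain ⟨g', h1', h2'⟩ := exists_smul_eq_mk_single hij hab'
  exact ⟨g'⁻¹ * g, by rw [mul_smul, h1, ← h1', inv_smul_smul],
    by rw [mul_smul, h2, ← h2', inv_smul_smul]⟩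

/-! ### Transvections and Iwasawa's criterion -/

lemma mem_submodule_smul (g : GeneralLinearGroup (Fin n) D) (l : ℙ D (Fin n → D))
    (w : Fin n → D) : w ∈ (g • l).submodule ↔ rowEquiv g⁻¹ w ∈ l.submodule := by
  induction l with | h v hv => ?_
  rw [line_smul_mk, submodule_mk, submodule_mk, Submodule.mem_span_singleton,
    Submodule.mem_span_singleton]
  refine exists_congr fun c => ?_
  rw [← map_smul]
  exact ⟨fun h => by rw [← h, rowEquiv_inv_rowEquiv], fun h => by rw [h, rowEquiv_rowEquiv_inv]⟩

/-- The transvections whose direction is the line `l`. -/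
def transvectionSubgroup (l : ℙ D (Fin n → D)) : Subgroup (specialLinearSubgroup n D) where
  carrier := {x | (∀ w : Fin n → D, rowEquiv x.1 w - w ∈ l.submodule) ∧
    ∀ w ∈ l.submodule, rowEquiv x.1 w = w}
  one_mem' := by simp
  mul_mem' := by
    rintro x y ⟨hx, hx'⟩ ⟨hy, hy'⟩
    refine ⟨fun w => ?_, fun w hw => by
      rw [Subgroup.coe_mul, rowEquiv_mul_apply, hy' w hw, hx' w hw]⟩
    rw [Subgroup.coe_mul, rowEquiv_mul_apply, ← sub_add_sub_cancel _ (rowEquiv y.1 w)]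
    exact add_mem (hx _) (hy _)
  inv_mem' := by
    rintro x ⟨hx, hx'⟩
    refine ⟨fun w => ?_, fun w hw => ?_⟩
    · rw [← neg_sub, neg_mem_iff, Subgroup.coe_inv]
      simpa using hx (rowEquiv x.1⁻¹ w)
    · rw [Subgroup.coe_inv]
      nth_rw 1 [← hx' w hw]
      exact rowEquiv_inv_rowEquiv _ _

lemma mem_transvectionSubgroup {l : ℙ D (Fin n → D)} {x : specialLinearSubgroup n D} :
    x ∈ transvectionSubgroup l ↔ (∀ w : Fin n → D, rowEquiv x.1 w - w ∈ l.submodule) ∧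
      ∀ w ∈ l.submodule, rowEquiv x.1 w = w := Iff.rfl

lemma rowEquiv_injective :
    Function.Injective (rowEquiv : GeneralLinearGroup (Fin n) D →* _) := fun _ _ h =>
  inv_injective (ext_vecMul fun w => DFunLike.congr_fun h w)

lemma elementaryUnit_mem_transvectionSubgroup {i j : Fin n} (hij : i ≠ j) (c : D) :
    (⟨elementaryUnit i j hij c, elementaryUnit_mem hij c⟩ : specialLinearSubgroup n D) ∈
      transvectionSubgroup (mk D (Pi.single j (1 : D)) (by simp)) := by
  rw [mem_transvectionSubgroup, submodule_mk]
  refine ⟨fun w => ?_, fun w hw => ?_⟩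
  · rw [rowEquiv_elementaryUnit, add_sub_cancel_left, Submodule.mem_span_singleton]
    exact ⟨w i * -c, by rw [← Pi.single_smul, smul_eq_mul, mul_one]⟩
  · obtain ⟨d, rfl⟩ := Submodule.mem_span_singleton.1 hw
    rw [rowEquiv_elementaryUnit]
    simp [hij]

/-- The transvection subgroups form an Iwasawa structure for the action on lines. -/
def transvectionIwasawaStructure :
    MulAction.IwasawaStructure (specialLinearSubgroup n D) (ℙ D (Fin n → D)) where
  T := transvectionSubgroup
  is_comm l := by
    refine ⟨⟨?_⟩⟩
    rintro ⟨⟨x, hxE⟩, hx, hx'⟩ ⟨⟨y, hyE⟩, hy, hy'⟩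
    refine Subtype.ext (Subtype.ext (rowEquiv_injective (LinearEquiv.ext fun w => ?_)))
    change rowEquiv (x * y) w = rowEquiv (y * x) w
    -- Each transvection fixes the other's displacement, so displacements add in either order.
    have h1 : rowEquiv (x * y) w = (rowEquiv y w - w) + rowEquiv x w := by
      rw [rowEquiv_mul_apply, ← hx' _ (hy w), ← map_add, sub_add_cancel]
    have h2 : rowEquiv (y * x) w = (rowEquiv x w - w) + rowEquiv y w := by
      rw [rowEquiv_mul_apply, ← hy' _ (hx w), ← map_add, sub_add_cancel]
    rw [h1, h2]
    abel
  is_conj := by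
    rintro ⟨g, hg⟩ l
    ext ⟨x, hx⟩
    rw [Subgroup.mem_pointwise_smul_iff_inv_smul_mem, ← map_inv, MulAut.smul_def, MulAut.conj_apply,
      mem_transvectionSubgroup, mem_transvectionSubgroup, Subgroup.mk_smul]
    simp only [mem_submodule_smul, Subgroup.coe_mul, Subgroup.coe_inv, inv_inv, rowEquiv_mul_apply]
    refine and_congr ⟨fun h w => ?_, fun h w => ?_⟩ ⟨fun h w hw => ?_, fun h w hw => ?_⟩
    · simpa using h (rowEquiv g w)
    · simpa using h (rowEquiv g⁻¹ w)
    · rw [h (rowEquiv g w) (by simpa using hw), rowEquiv_inv_rowEquiv]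
    · simpa using congrArg (rowEquiv g) (h (rowEquiv g⁻¹ w) hw)
  is_generator := by
    rw [eq_top_iff, ← Subgroup.map_subtype_le_map_subtype, ← MonoidHom.range_eq_map,
      Subgroup.range_subtype, specialLinearSubgroup_le_iff]
    exact fun i j hij c => ⟨_, le_iSup transvectionSubgroup _
      (elementaryUnit_mem_transvectionSubgroup hij c), rfl⟩

/-- A normal subgroup of `SL_n(D)` moving some line is all of `SL_n(D)`. -/
lemma eq_top_of_normal_of_smul_ne [Infinite D] [Nontrivial (Fin n)]
    {K : Subgroup (specialLinearSubgroup n D)} (hK : K.Normal) {x : specialLinearSubgroup n D}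
    (hx : x ∈ K) {l : ℙ D (Fin n → D)} (hl : x • l ≠ l) : K = ⊤ := by
  have h := transvectionIwasawaStructure.commutator_le K
    (fun h => hl (Set.eq_univ_iff_forall.1 h l ⟨x, hx⟩))
  rw [eq_top_iff]
  refine le_trans ?_ h
  rw [← Subgroup.map_subtype_le_map_subtype, commutator_def, Subgroup.map_commutator,
    ← MonoidHom.range_eq_map, Subgroup.range_subtype, commutator_specialLinearSubgroup]

/-- Each `e_i` is scaled by some `m i`. Since `e_i + a e_j` is scaled too, `a * m j = m i * a`; thus
the `m i` are one central scalar. -/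
lemma mem_center_of_forall_smul_eq [Nontrivial (Fin n)] {g : GeneralLinearGroup (Fin n) D}
    (hg : ∀ l : ℙ D (Fin n → D), g • l = l) :
    g ∈ Subgroup.center (GeneralLinearGroup (Fin n) D) := by
  have H : ∀ w : Fin n → D, w ≠ 0 → ∃ c : D, rowEquiv g w = c • w := fun w hw => by
    have := hg (mk D w hw)
    rw [line_smul_mk, mk_eq_mk_iff'] at this
    obtain ⟨c, hc⟩ := this
    exact ⟨c, hc.symm⟩
  choose! m hm using fun i : Fin n => H (Pi.single i 1) (by simp)
  have key : ∀ i j, i ≠ j → ∀ a : D, a * m j = m i * a := fun i j hij a => by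
    obtain ⟨c, hc⟩ := H (Pi.single i 1 + a • Pi.single j 1) fun h0 => by
      simpa [hij] using congrFun h0 i
    rw [map_add, map_smul, hm, hm] at hc
    have h1 := congrFun hc i
    have h2 := congrFun hc j
    simp [hij, hij.symm] at h1 h2
    rw [h2, h1]
  have hconst : ∀ i j, m i = m j := fun i j => by
    rcases eq_or_ne i j with rfl | hij
    · rfl
    · simpa using (key i j hij 1).symm
  obtain ⟨i, j, hij⟩ := exists_pair_ne (Fin n)
  have hcomm : ∀ a : D, a * m i = m i * a := fun a => by rw [← key i j hij a, hconst i j]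
  have hsmul : ∀ w : Fin n → D, rowEquiv g w = m i • w := fun w => by
    rw [← Finset.univ_sum_single w, map_sum, Finset.smul_sum]
    refine Finset.sum_congr rfl fun k _ => ?_
    rw [← mul_one (w k), ← smul_eq_mul, Pi.single_smul, map_smul, hm, hconst k i, smul_smul,
      smul_smul, hcomm]
  rw [← inv_mem_iff, Subgroup.mem_center_iff]
  refine fun h => ext_vecMul fun w => ?_
  rw [Units.val_mul, Units.val_mul, ← vecMul_vecMul, ← vecMul_vecMul, ← rowEquiv_apply,
    ← rowEquiv_apply, hsmul, hsmul, smul_vecMul]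

/-! ### Subgroups forced to contain `SL_n(D)` -/

/-- A subgroup normalized by `SL_n(D)` and not central contains `SL_n(D)`. -/
lemma specialLinearSubgroup_le_of_le_normalizer [Infinite D] [Nontrivial (Fin n)]
    {N : Subgroup (GeneralLinearGroup (Fin n) D)}
    (hN : ¬ N ≤ Subgroup.center (GeneralLinearGroup (Fin n) D))
    (hnorm : ∀ s ∈ specialLinearSubgroup n D, ∀ g ∈ N, s * g * s⁻¹ ∈ N) :
    specialLinearSubgroup n D ≤ N := by
  obtain ⟨g, hg, hgc⟩ := SetLike.not_le_iff_exists.1 hN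
  obtain ⟨l, hl⟩ : ∃ l : ℙ D (Fin n → D), g • l ≠ l := by
    by_contra! H
    exact hgc (mem_center_of_forall_smul_eq H)
  -- In coordinates where `g • l = ⟨e_i⟩` and `l = ⟨e_j⟩`, the transvection `t` fixes `e_j` and
  -- sends `e_i` to `e_i - e_j`.
  obtain ⟨s, hs, hsl⟩ : ∃ s : specialLinearSubgroup n D, s • l = l ∧ s • (g • l) ≠ g • l := by
    obtain ⟨i, j, hij⟩ := exists_pair_ne (Fin n)
    obtain ⟨r, h1, h2⟩ := exists_smul_eq_mk_single hij hl
    set t : specialLinearSubgroup n D := ⟨_, elementaryUnit_mem hij 1⟩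
    refine ⟨r⁻¹ * t * r, ?_, fun h => ?_⟩
    · rw [mul_smul, mul_smul, h2, inv_smul_eq_iff, h2, subgroup_line_smul_mk]
      congr 1
      rw [rowEquiv_elementaryUnit]
      simp [hij]
    · rw [mul_smul, mul_smul, h1, inv_smul_eq_iff, h1, subgroup_line_smul_mk, mk_eq_mk_iff'] at h
      obtain ⟨a, ha⟩ := h
      rw [rowEquiv_elementaryUnit] at ha
      simpa [hij.symm] using congrFun ha j
  have hsN : ⁅(s : GeneralLinearGroup (Fin n) D), g⁆ ∈ N := by
    rw [commutatorElement_def]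
    exact mul_mem (hnorm s s.2 g hg) (inv_mem hg)
  have hsE : ⁅(s : GeneralLinearGroup (Fin n) D), g⁆ ∈ specialLinearSubgroup n D := by
    rw [commutatorElement_def, mul_assoc, mul_assoc, ← mul_assoc g]
    exact mul_mem s.2 (specialLinearSubgroup_normal.conj_mem _ (inv_mem s.2) g)
  have hnormal : (N.subgroupOf (specialLinearSubgroup n D)).Normal :=
    ⟨fun x hx y => hnorm y y.2 x hx⟩
  rw [← Subgroup.subgroupOf_eq_top]
  -- As `s⁻¹` fixes `l`, the commutator sends `g • l` to `s • g • l`, a different line.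
  refine eq_top_of_normal_of_smul_ne hnormal (x := ⟨_, hsE⟩) hsN (l := g • l) ?_
  rw [Subgroup.mk_smul, commutatorElement_def, mul_smul, mul_smul, mul_smul, inv_smul_smul]
  have : (s : GeneralLinearGroup (Fin n) D)⁻¹ • l = l := by
    rw [inv_smul_eq_iff]; exact hs.symm
  rw [this]
  exact hsl

lemma specialLinearSubgroup_le_of_finiteIndex [Infinite D] [Nontrivial (Fin n)]
    {K : Subgroup (GeneralLinearGroup (Fin n) D)}
    (hK : (K.subgroupOf (specialLinearSubgroup n D)).FiniteIndex) :
    specialLinearSubgroup n D ≤ K := by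
  obtain ⟨i, j, hij⟩ := exists_pair_ne (Fin n)
  set C := (K.subgroupOf (specialLinearSubgroup n D)).normalCore
  let t : D → specialLinearSubgroup n D := fun c => ⟨_, elementaryUnit_mem hij c⟩
  -- Infinitely many `t c` fall into finitely many cosets of the core.
  obtain ⟨b, c, hbc, h⟩ := Finite.exists_ne_map_eq_of_infinite
    fun c => (t c : specialLinearSubgroup n D ⧸ C)
  have hmem : t (-b + c) ∈ C := by
    have := QuotientGroup.eq.1 h
    rwa [show (t b)⁻¹ * t c = t (-b + c) from Subtype.ext
      (by simp only [t, Subgroup.coe_mul, Subgroup.coe_inv, elementaryUnit_inv,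
            elementaryUnit_mul])] at this
  have htop : C = ⊤ := by
    refine eq_top_of_normal_of_smul_ne (Subgroup.normalCore_normal _) hmem
      (l := mk D (Pi.single i 1) (by simp)) fun hl => hbc ?_
    rw [subgroup_line_smul_mk, mk_eq_mk_iff', rowEquiv_elementaryUnit] at hl
    obtain ⟨a, ha⟩ := hl
    have := congrFun ha j
    simp [hij.symm] at this
    exact (neg_add_eq_zero.1 this.symm).symm
  rw [← Subgroup.subgroupOf_eq_top, eq_top_iff, ← htop]
  exact Subgroup.normalCore_le _

lemma IsAlmostSubnormal.specialLinearSubgroup_le [Infinite D] [Nontrivial (Fin n)]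
    {N : Subgroup (GeneralLinearGroup (Fin n) D)} (hsub : IsAlmostSubnormal N)
    (hN : ¬ N ≤ Subgroup.center (GeneralLinearGroup (Fin n) D)) :
    specialLinearSubgroup n D ≤ N := by
  obtain ⟨r, S, h0, rfl, hS⟩ := hsub
  have hle : ∀ i ≤ r, S r ≤ S i := fun i hi => by
    induction hi using Nat.decreasingInduction with
    | self => exact le_rfl
    | of_succ k hk ih => exact ih.trans (hS k hk).1
  have H : ∀ i ≤ r, specialLinearSubgroup n D ≤ S i := fun i => by
    induction i with
    | zero => exact fun _ => h0 ▸ le_top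
    | succ i ih =>
      intro hi
      have hE := ih (Nat.le_of_succ_le hi)
      obtain ⟨hle', hnorm | hfin⟩ := hS i hi
      -- Every term of the chain contains the non-central last term, hence is non-central.
      · refine specialLinearSubgroup_le_of_le_normalizer (fun h => hN ((hle _ hi).trans h)) ?_
        exact fun s hs g hg => hnorm.conj_mem ⟨g, hle' hg⟩ hg ⟨s, hE hs⟩
      · refine specialLinearSubgroup_le_of_finiteIndex ⟨?_⟩
        exact Subgroup.relIndex_ne_zero_trans (H := S (i + 1)) (K := S i) hfin.index_ne_zero
          (by rw [Subgroup.relIndex_eq_one.2 hE]; exact one_ne_zero)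
  exact H r le_rfl

lemma Subgroup.IsSubnormal.isAlmostSubnormal {G : Type*} [Group G] {H : Subgroup G}
    (hH : H.IsSubnormal) : IsAlmostSubnormal H := by
  induction hH with
  | top => exact ⟨0, fun _ => ⊤, rfl, rfl, by simp⟩
  | step H K hle _ hnorm ih =>
    obtain ⟨r, S, h0, hr, hS⟩ := ih
    refine ⟨r + 1, fun i => if i ≤ r then S i else H, by simp [h0], by simp, fun i hi => ?_⟩
    beta_reduce
    rcases Nat.lt_succ_iff_lt_or_eq.1 hi with hi | rfl
    · rw [if_pos hi.le, if_pos (Nat.succ_le_of_lt hi)]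
      exact hS i hi
    · rw [if_pos le_rfl, if_neg (Nat.not_succ_le_self i), hr]
      exact ⟨hle, Or.inl hnorm⟩

end

theorem theorem3p4 {D : Type*} [DivisionRing D] [Infinite D] (n : ℕ) (hn : 2 ≤ n)
    (N : Subgroup (Matrix.GeneralLinearGroup (Fin n) D))
    (hN : ¬ N ≤ Subgroup.center (Matrix.GeneralLinearGroup (Fin n) D)) :
    List.TFAE [
      IsAlmostSubnormal N,
      N.IsSubnormal,
      N.Normal,
      specialLinearSubgroup n D ≤ N] := by
  have : Nontrivial (Fin n) := Fin.nontrivial_iff_two_le.2 hn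
  tfae_have 1 → 4 := fun h => h.specialLinearSubgroup_le hN
  tfae_have 4 → 3 := normal_of_specialLinearSubgroup_le
  tfae_have 3 → 2 := Subgroup.Normal.isSubnormal
  tfae_have 2 → 1 := Subgroup.IsSubnormal.isAlmostSubnormal
  tfae_finish
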